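/- Let $0<d_1<\cdots<d_k<n$ be integers, and write $[n]=\{1,\dots,n\}$. For $0<d<n$ let $G(d,n)$ be the Grassmannian of $d$-dimensional linear subspaces of $\mathbb{C}^n$. The Plücker coordinates $(p_I(W))_{I\subset[n],\,|I|=d}$ of $W\in G(d,n)$ are the maximal minors of a $d\times n$ matrix whose rows form a basis of $W$; they are well defined up to a common nonzero factor and embed $G(d,n)$ in $\mathbb{P}_{\mathbb{C}}^{\binom{n}{d}-1}$. Let $$\mathbb{F}=\mathbb{F}_{d_1<\cdots<d_k}(\mathbb{C}^n)=\{(W_1,\dots,W_k) : W_1\subset\cdots\subset W_k\subset\mathbb{C}^n,\ \dim W_i=d_i\}\subset\prod_{i=1}^kG(d_i,n)$$ be the flag variety, regarded through the Plücker embeddings as a closed subvariety of $\prod_{i=1}^k\mathbb{P}_{\mathbb{C}}^{\binom{n}{d_i}-1}$. For a matroid $M$ of rank $d$ on the ground set $[n]$ let $B_M$ be its set of bases, and let $G_M=\{W\in G(d,n) : p_I(W)\neq0\Leftrightarrow I\in B_M\ \text{for all } I\subset[n],\ |I|=d\}$. Let $\mathbf{M}=(M_1,\dots,M_k)$ be a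 plurimatroid, i.e. $M_i$ is a matroid of rank $d_i$ on $[n]$ for every $i$. Then the thin Schubert cell $$\mathbb{F}_{\mathbf{M}}:=\Big(\prod_{i=1}^kG_{M_i}\Big)\cap\mathbb{F}=\{(W_1,\dots,W_k)\in\mathbb{F} : p_I(W_i)\neq0\Leftrightarrow I\in B_{M_i}\ \text{for all } i \text{ and all } I\subset[n],\ |I|=d_i\}$$ is a locally closed subset of $\mathbb{F}$ in the Zariski topology, and, with the (reduced) structure induced from $\mathbb{F}$, it is an affine variety, i.e. isomorphic to a closed algebraic subset (possibly empty or reducible) of some affine space $\mathbb{C}^N$. -/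

import Mathlib

open scoped LinearAlgebra.Projectivization

noncomputable section

namespace ThinCell

/-! ### Spaces with regular functions -/

/-- A sheaf of `ℂ`-algebras of `ℂ`-valued functions on a topological space. `IsRegularOn U f` says
that the restriction of `f` to `U` is a regular function; only the values of `f` on `U` matter, and
the notion is only used for open `U`. -/
class RegularFunctions (X : Type*) [TopologicalSpace X] where
  IsRegularOn : Set X → (X → ℂ) → Prop
  mono : ∀ {U V : Set X} {f : X → ℂ}, V ⊆ U → IsRegularOn U f → IsRegularOn V f
  locality : ∀ {U : Set X} {f : X → ℂ},
    (∀ x ∈ U, ∃ V : Set X, IsOpen V ∧ x ∈ V ∧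
      ∃ g : X → ℂ, IsRegularOn (V ∩ U) g ∧ Set.EqOn f g (V ∩ U)) → IsRegularOn U f
  const : ∀ (U : Set X) (c : ℂ), IsRegularOn U fun _ => c
  add : ∀ {U : Set X} {f g : X → ℂ}, IsRegularOn U f → IsRegularOn U g → IsRegularOn U (f + g)
  mul : ∀ {U : Set X} {f g : X → ℂ}, IsRegularOn U f → IsRegularOn U g → IsRegularOn U (f * g)

/-- The functions that are locally of the form `p / q`, where `(p, q)` runs through a family `D` of
allowed pairs (numerator, denominator) and `q` does not vanish. -/
@[reducible]
def RegularFunctions.ofFractions {X : Type*} [TopologicalSpace X] (D : (X → ℂ) → (X → ℂ) → Prop)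
    (hconst : ∀ c : ℂ, D (fun _ => c) 1)
    (hadd : ∀ {p q p' q' : X → ℂ}, D p q → D p' q' → D (p * q' + p' * q) (q * q'))
    (hmul : ∀ {p q p' q' : X → ℂ}, D p q → D p' q' → D (p * p') (q * q')) :
    RegularFunctions X where
  IsRegularOn U f := ∀ x ∈ U, ∃ V : Set X, IsOpen V ∧ x ∈ V ∧ ∃ p q : X → ℂ, D p q ∧
    ∀ y ∈ V ∩ U, q y ≠ 0 ∧ f y = p y / q y
  mono hVU hf x hx := by
    obtain ⟨V, hV, hxV, p, q, hD, h⟩ := hf x (hVU hx)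
    exact ⟨V, hV, hxV, p, q, hD, fun y hy => h y ⟨hy.1, hVU hy.2⟩⟩
  locality {U f} h x hx := by
    obtain ⟨V, hV, hxV, g, hg, hfg⟩ := h x hx
    obtain ⟨V', hV', hxV', p, q, hD, h'⟩ := hg x ⟨hxV, hx⟩
    refine ⟨V ∩ V', hV.inter hV', ⟨hxV, hxV'⟩, p, q, hD, fun y hy => ?_⟩
    have h1 := h' y ⟨hy.1.2, hy.1.1, hy.2⟩
    exact ⟨h1.1, (hfg ⟨hy.1.1, hy.2⟩).trans h1.2⟩
  const U c x _ := ⟨Set.univ, isOpen_univ, trivial, _, _, hconst c, fun y _ => by simp⟩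
  add {U f g} hf hg x hx := by
    obtain ⟨V, hV, hxV, p, q, hD, h⟩ := hf x hx
    obtain ⟨V', hV', hxV', p', q', hD', h'⟩ := hg x hx
    refine ⟨V ∩ V', hV.inter hV', ⟨hxV, hxV'⟩, _, _, hadd hD hD', fun y hy => ?_⟩
    obtain ⟨h1, h2⟩ := h y ⟨hy.1.1, hy.2⟩
    obtain ⟨h3, h4⟩ := h' y ⟨hy.1.2, hy.2⟩
    refine ⟨mul_ne_zero h1 h3, ?_⟩
    simp only [Pi.add_apply, Pi.mul_apply, h2, h4]
    field_simp
  mul {U f g} hf hg x hx := by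
    obtain ⟨V, hV, hxV, p, q, hD, h⟩ := hf x hx
    obtain ⟨V', hV', hxV', p', q', hD', h'⟩ := hg x hx
    refine ⟨V ∩ V', hV.inter hV', ⟨hxV, hxV'⟩, _, _, hmul hD hD', fun y hy => ?_⟩
    obtain ⟨h1, h2⟩ := h y ⟨hy.1.1, hy.2⟩
    obtain ⟨h3, h4⟩ := h' y ⟨hy.1.2, hy.2⟩
    refine ⟨mul_ne_zero h1 h3, ?_⟩
    simp only [Pi.mul_apply, h2, h4]
    field_simp

/-- The induced (reduced) structure along `ι : X → Y`: a function on `X` is regular if it is locally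
the restriction of a regular function on an open subset of `Y`. -/
@[reducible]
def RegularFunctions.induced {X Y : Type*} [TopologicalSpace X] [TopologicalSpace Y]
    [RegularFunctions Y] (ι : X → Y) (hι : Topology.IsInducing ι) : RegularFunctions X where
  IsRegularOn U f := ∀ x ∈ U, ∃ V : Set Y, IsOpen V ∧ ι x ∈ V ∧ ∃ g : Y → ℂ,
    RegularFunctions.IsRegularOn V g ∧ ∀ y ∈ U, ι y ∈ V → f y = g (ι y)
  mono hVU hf x hx := by
    obtain ⟨V, hV, hxV, g, hg, h⟩ := hf x (hVU hx)
    exact ⟨V, hV, hxV, g, hg, fun y hy => h y (hVU hy)⟩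
  locality {U f} h x hx := by
    obtain ⟨V, hV, hxV, g, hg, hfg⟩ := h x hx
    obtain ⟨V₀, hV₀, rfl⟩ := hι.isOpen_iff.1 hV
    obtain ⟨V', hV', hxV', g', hg', h'⟩ := hg x ⟨hxV, hx⟩
    refine ⟨V₀ ∩ V', hV₀.inter hV', ⟨hxV, hxV'⟩, g',
      RegularFunctions.mono Set.inter_subset_right hg', fun y hy hyV => ?_⟩
    exact (hfg ⟨hyV.1, hy⟩).trans (h' y ⟨hyV.1, hy⟩ hyV.2)
  const U c x _ := ⟨Set.univ, isOpen_univ, trivial, fun _ => c, RegularFunctions.const _ _,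
    fun _ _ _ => rfl⟩
  add {U f f'} hf hf' x hx := by
    obtain ⟨V, hV, hxV, g, hg, h⟩ := hf x hx
    obtain ⟨V', hV', hxV', g', hg', h'⟩ := hf' x hx
    exact ⟨V ∩ V', hV.inter hV', ⟨hxV, hxV'⟩, g + g',
      RegularFunctions.add (RegularFunctions.mono Set.inter_subset_left hg)
        (RegularFunctions.mono Set.inter_subset_right hg'),
      fun y hy hyV => by simp [h y hy hyV.1, h' y hy hyV.2]⟩
  mul {U f f'} hf hf' x hx := by
    obtain ⟨V, hV, hxV, g, hg, h⟩ := hf x hx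
    obtain ⟨V', hV', hxV', g', hg', h'⟩ := hf' x hx
    exact ⟨V ∩ V', hV.inter hV', ⟨hxV, hxV'⟩, g * g',
      RegularFunctions.mul (RegularFunctions.mono Set.inter_subset_left hg)
        (RegularFunctions.mono Set.inter_subset_right hg'),
      fun y hy hyV => by simp [h y hy hyV.1, h' y hy hyV.2]⟩

/-- Subsets carry the induced structure. -/
instance {X : Type*} [TopologicalSpace X] [RegularFunctions X] (S : Set X) : RegularFunctions S :=
  RegularFunctions.induced Subtype.val Topology.IsInducing.subtypeVal

/-- An isomorphism of spaces with regular functions: a homeomorphism that identifies the regular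
functions on corresponding open subsets. -/
structure RegularIso (X Y : Type*) [TopologicalSpace X] [RegularFunctions X]
    [TopologicalSpace Y] [RegularFunctions Y] extends X ≃ₜ Y where
  isRegularOn_iff : ∀ (U : Set Y) (f : Y → ℂ), IsOpen U →
    (RegularFunctions.IsRegularOn U f ↔
      RegularFunctions.IsRegularOn (toHomeomorph ⁻¹' U) (f ∘ toHomeomorph))

/-! ### Affine space and affine varieties -/

/-- The points of complex affine `N`-space, a type of its own because it carries the Zariski
topology. -/
structure AffSpace (N : ℕ) where
  coord : Fin N → ℂ

/-- The Zariski topology: the sets `{P ≠ 0}` form a basis. -/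
instance (N : ℕ) : TopologicalSpace (AffSpace N) :=
  TopologicalSpace.generateFrom
    {U | ∃ P : MvPolynomial (Fin N) ℂ, U = {x : AffSpace N | MvPolynomial.eval x.coord P ≠ 0}}

instance (N : ℕ) : RegularFunctions (AffSpace N) :=
  RegularFunctions.ofFractions
    (fun p q => ∃ P Q : MvPolynomial (Fin N) ℂ,
      (p = fun x : AffSpace N => MvPolynomial.eval x.coord P) ∧
      (q = fun x : AffSpace N => MvPolynomial.eval x.coord Q))
    (fun c => ⟨MvPolynomial.C c, 1, by simp, by ext; simp⟩)
    (by
      rintro _ _ _ _ ⟨P, Q, rfl, rfl⟩ ⟨P', Q', rfl, rfl⟩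
      exact ⟨P * Q' + P' * Q, Q * Q', by ext; simp, by ext; simp⟩)
    (by
      rintro _ _ _ _ ⟨P, Q, rfl, rfl⟩ ⟨P', Q', rfl, rfl⟩
      exact ⟨P * P', Q * Q', by ext; simp, by ext; simp⟩)

/-- The zero locus of an ideal, as a subset of affine space. -/
def affineZeroLocus {N : ℕ} (I : Ideal (MvPolynomial (Fin N) ℂ)) : Set (AffSpace N) :=
  {x | x.coord ∈ MvPolynomial.zeroLocus ℂ I}

/-- A space with regular functions is affine if it is isomorphic to a closed algebraic subset of
some affine space (not necessarily irreducible, possibly empty). -/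
def IsAffineVariety (X : Type*) [TopologicalSpace X] [RegularFunctions X] : Prop :=
  ∃ (N : ℕ) (I : Ideal (MvPolynomial (Fin N) ℂ)), Nonempty (RegularIso X (affineZeroLocus I))

/-! ### Products of projective spaces -/

/-- The points of the product of the projective spaces `ℙ(ℂ^(σ i))`. -/
structure MultiProj {k : ℕ} (σ : Fin k → Type) where
  pt : ∀ i, ℙ ℂ (σ i → ℂ)

/-- `P` is multihomogeneous of multidegree `e`: for every `i`, each monomial of `P` has degree `e i`
in the `i`-th block of variables. -/
def IsMultihomogeneous {k : ℕ} {σ : Fin k → Type} (P : MvPolynomial (Σ i, σ i) ℂ)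
    (e : Fin k → ℕ) : Prop :=
  MvPolynomial.IsWeightedHomogeneous (fun s : Σ i, σ i => (Pi.single s.1 1 : Fin k → ℕ)) P e

/-- The value of `P` at the chosen homogeneous coordinates of `x`. For multihomogeneous `P, Q` of the
same multidegree, neither the vanishing of `P` nor the quotient of the values of `P` and `Q` depends
on the choice. -/
def MultiProj.evalRep {k : ℕ} {σ : Fin k → Type} (P : MvPolynomial (Σ i, σ i) ℂ)
    (x : MultiProj σ) : ℂ :=
  MvPolynomial.eval (fun s : Σ i, σ i => (x.pt s.1).rep s.2) P

/-- Rescaling the blocks of variables rescales the value of a multihomogeneous polynomial. -/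
theorem IsMultihomogeneous.eval_smul {k : ℕ} {σ : Fin k → Type} {P : MvPolynomial (Σ i, σ i) ℂ}
    {e : Fin k → ℕ} (hP : IsMultihomogeneous P e) (v : ∀ i, σ i → ℂ) (t : Fin k → ℂ) :
    MvPolynomial.eval (fun s : Σ i, σ i => t s.1 * v s.1 s.2) P =
      (∏ i, t i ^ e i) * MvPolynomial.eval (fun s : Σ i, σ i => v s.1 s.2) P := by
  classical
  rw [MvPolynomial.eval_eq, MvPolynomial.eval_eq, Finset.mul_sum]
  refine Finset.sum_congr rfl fun m hm => ?_
  have hw := hP (MvPolynomial.mem_support_iff.1 hm)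
  have ht : ∏ s ∈ m.support, t s.1 ^ m s = ∏ i, t i ^ e i := by
    rw [← hw, Finsupp.weight_apply, Finsupp.sum]
    simp only [Finset.sum_apply, Pi.smul_apply, smul_eq_mul, ← Finset.prod_pow_eq_pow_sum]
    rw [Finset.prod_comm]
    refine Finset.prod_congr rfl fun s _ => ?_
    rw [Finset.prod_eq_single s.1]
    · simp
    · intro i _ hi
      simp [hi]
    · simp
  simp only [mul_pow, Finset.prod_mul_distrib, ht]
  ring

/-- The Zariski topology: the sets `{P ≠ 0}` with `P` multihomogeneous form a basis. -/
instance {k : ℕ} (σ : Fin k → Type) : TopologicalSpace (MultiProj σ) :=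
  TopologicalSpace.generateFrom
    {U | ∃ (P : MvPolynomial (Σ i, σ i) ℂ) (e : Fin k → ℕ), IsMultihomogeneous P e ∧
      U = {x : MultiProj σ | x.evalRep P ≠ 0}}

/-- The regular functions are locally quotients of multihomogeneous polynomials of the same
multidegree. -/
instance {k : ℕ} (σ : Fin k → Type) : RegularFunctions (MultiProj σ) :=
  RegularFunctions.ofFractions
    (fun p q => ∃ (P Q : MvPolynomial (Σ i, σ i) ℂ) (e : Fin k → ℕ),
      IsMultihomogeneous P e ∧ IsMultihomogeneous Q e ∧
      (p = fun x : MultiProj σ => x.evalRep P) ∧ (q = fun x : MultiProj σ => x.evalRep Q))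
    (fun c => ⟨MvPolynomial.C c, 1, 0, MvPolynomial.isWeightedHomogeneous_C _ _,
      MvPolynomial.isWeightedHomogeneous_one _ _, by simp [MultiProj.evalRep],
      by ext; simp [MultiProj.evalRep]⟩)
    (by
      rintro _ _ _ _ ⟨P, Q, e, hP, hQ, rfl, rfl⟩ ⟨P', Q', e', hP', hQ', rfl, rfl⟩
      refine ⟨P * Q' + P' * Q, Q * Q', e + e', ?_, hQ.mul hQ', by ext; simp [MultiProj.evalRep],
        by ext; simp [MultiProj.evalRep]⟩
      have h := hP'.mul hQ
      rw [add_comm] at h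
      exact (MvPolynomial.weightedHomogeneousSubmodule ℂ _ _).add_mem (hP.mul hQ') h)
    (by
      rintro _ _ _ _ ⟨P, Q, e, hP, hQ, rfl, rfl⟩ ⟨P', Q', e', hP', hQ', rfl, rfl⟩
      exact ⟨P * P', Q * Q', e + e', hP.mul hP', hQ.mul hQ', by ext; simp [MultiProj.evalRep],
        by ext; simp [MultiProj.evalRep]⟩)

/-! ### Grassmannians and Plücker coordinates -/

/-- The set of `d`-element subsets of `[n]`. -/
abbrev Subsets (n d : ℕ) : Type := {I : Finset (Fin n) // I.card = d}

/-- The Grassmannian `G(d, n)` of `d`-dimensional linear subspaces of `ℂⁿ`. -/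
structure Gr (d n : ℕ) where
  space : Submodule ℂ (Fin n → ℂ)
  finrank_eq : Module.finrank ℂ space = d

/-- The maximal minors of the `d × n` matrix with rows `b 0, …, b (d - 1)`. -/
def minors {n d : ℕ} (b : Fin d → Fin n → ℂ) (I : Subsets n d) : ℂ :=
  (Matrix.of fun r c : Fin d => b r (I.1.orderEmbOfFin I.2 c)).det

theorem minors_ne_zero {n d : ℕ} {b : Fin d → Fin n → ℂ} (hb : LinearIndependent ℂ b) :
    minors b ≠ 0 := by
  classical
  have hrank : Module.finrank ℂ (Submodule.span ℂ (Set.range (Matrix.of b).col)) = d := by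
    have h : LinearIndependent ℂ (Matrix.of b).row := hb
    rw [← Matrix.rank_eq_finrank_span_cols]
    simpa using h.rank_matrix
  obtain ⟨κ, a, ha, hspan, hli⟩ := exists_linearIndependent' ℂ (Matrix.of b).col
  have : Finite κ := Finite.of_injective a ha
  have := Fintype.ofFinite κ
  have hκ : Fintype.card κ = d := by
    rw [← hrank, ← hspan, finrank_span_eq_card hli]
  let I : Subsets n d := ⟨Finset.univ.image a, by
    rw [Finset.card_image_of_injective _ ha, Finset.card_univ, hκ]⟩
  have hmem : ∀ c, ∃ x, a x = I.1.orderEmbOfFin I.2 c := fun c => by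
    have := I.1.orderEmbOfFin_mem I.2 c
    exact (Finset.mem_image.1 this).imp fun x hx => hx.2
  choose e he using hmem
  have hinj : Function.Injective e := fun c c' h =>
    (I.1.orderEmbOfFin I.2).injective (by rw [← he, ← he, h])
  have hcols := hli.comp e hinj
  intro h0
  have hunit : IsUnit (Matrix.of fun r c : Fin d => b r (I.1.orderEmbOfFin I.2 c)) := by
    rw [← Matrix.linearIndependent_cols_iff_isUnit]
    have h : (Matrix.of fun r c : Fin d => b r (I.1.orderEmbOfFin I.2 c)).col =
        ((Matrix.of b).col ∘ a) ∘ e := by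
      funext c r
      simp only [Function.comp_apply, he]
      rfl
    rw [h]
    exact hcols
  rw [Matrix.isUnit_iff_isUnit_det] at hunit
  exact hunit.ne_zero (congrFun h0 I)

theorem minors_change {n d : ℕ} (b : Fin d → Fin n → ℂ) (A : Matrix (Fin d) (Fin d) ℂ) :
    minors (fun r => ∑ s, A r s • b s) = A.det • minors b := by
  funext I
  rw [Pi.smul_apply, smul_eq_mul, minors, minors, ← Matrix.det_mul]
  congr 1
  ext r c
  simp [Matrix.mul_apply]

theorem linearIndependent_coe {n d : ℕ} {W : Submodule ℂ (Fin n → ℂ)}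
    (b : Module.Basis (Fin d) ℂ W) : LinearIndependent ℂ fun r => (b r : Fin n → ℂ) :=
  b.linearIndependent.map' W.subtype (Submodule.ker_subtype W)

/-- The Plücker embedding `ψ`: the point whose homogeneous coordinates are the maximal minors of a
matrix whose rows form a basis of `W`. -/
def plucker {n d : ℕ} (W : Gr d n) : ℙ ℂ (Subsets n d → ℂ) :=
  Projectivization.mk ℂ
    (minors fun r => (Module.finBasisOfFinrankEq ℂ W.space W.finrank_eq r : Fin n → ℂ))
    (minors_ne_zero (linearIndependent_coe _))

/-- The Plücker point can be computed with any basis. -/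
theorem plucker_eq {n d : ℕ} (W : Gr d n) (b : Module.Basis (Fin d) ℂ W.space) :
    plucker W = Projectivization.mk ℂ (minors fun r => (b r : Fin n → ℂ))
      (minors_ne_zero (linearIndependent_coe b)) := by
  rw [plucker, Projectivization.mk_eq_mk_iff']
  refine ⟨(Matrix.of fun r s => b.repr (Module.finBasisOfFinrankEq ℂ W.space W.finrank_eq r) s).det, ?_⟩
  rw [← minors_change]
  congr 1
  funext r
  conv_rhs => rw [← b.sum_repr (Module.finBasisOfFinrankEq ℂ W.space W.finrank_eq r)]
  simp only [Submodule.coe_sum, Submodule.coe_smul, Matrix.of_apply]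

/-- The `I`-th Plücker coordinate of `W`, for the chosen homogeneous coordinates of the Plücker
point. It is determined by `W` up to a nonzero factor that does not depend on `I`. -/
def pluckerCoord {n d : ℕ} (W : Gr d n) (I : Subsets n d) : ℂ := (plucker W).rep I

/-- Whether a Plücker coordinate vanishes can be checked with any basis. -/
theorem pluckerCoord_ne_zero_iff {n d : ℕ} (W : Gr d n) (b : Module.Basis (Fin d) ℂ W.space)
    (I : Subsets n d) :
    pluckerCoord W I ≠ 0 ↔ minors (fun r => (b r : Fin n → ℂ)) I ≠ 0 := by
  obtain ⟨a, ha⟩ := Projectivization.exists_smul_eq_mk_rep ℂ _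
    (minors_ne_zero (linearIndependent_coe b))
  rw [pluckerCoord, plucker_eq W b, ← ha]
  simp [Units.smul_def]

/-! ### Flag varieties -/

/-- The flag variety `𝔽_{d₁ < ⋯ < d_k}(ℂⁿ)`: the tuples in `∏ i, G(d i, n)` with
`W₁ ⊆ ⋯ ⊆ W_k`. -/
structure FlagVariety {k : ℕ} (n : ℕ) (d : Fin k → ℕ) where
  toGr : ∀ i, Gr (d i) n
  mono : ∀ i j, i ≤ j → (toGr i).space ≤ (toGr j).space

/-- The product `Ψ` of the Plücker embeddings, restricted to the flag variety. -/
def FlagVariety.plucker {k n : ℕ} {d : Fin k → ℕ} (W : FlagVariety n d) :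
    MultiProj fun i => Subsets n (d i) :=
  ⟨fun i => ThinCell.plucker (W.toGr i)⟩

/-- The Zariski topology of the flag variety, as a subvariety of a product of projective spaces. -/
instance {k n : ℕ} (d : Fin k → ℕ) : TopologicalSpace (FlagVariety n d) :=
  TopologicalSpace.induced FlagVariety.plucker inferInstance

instance {k n : ℕ} (d : Fin k → ℕ) : RegularFunctions (FlagVariety n d) :=
  RegularFunctions.induced FlagVariety.plucker ⟨rfl⟩

/-! ### Matroids and thin Schubert cells -/

/-- A matroid of rank `d` on the ground set `[n]`. A plurimatroid is a tuple of these. -/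
structure RankMatroid (d n : ℕ) where
  matroid : Matroid (Fin n)
  ground_eq : matroid.E = Set.univ
  eRank_eq : matroid.eRank = d

/-- `I` is a basis of `M`. -/
def RankMatroid.IsBasis {d n : ℕ} (M : RankMatroid d n) (I : Subsets n d) : Prop :=
  M.matroid.IsBase (I.1 : Set (Fin n))

/-- The thin Schubert cell `G_M` in the Grassmannian: the subspaces whose nonzero Plücker coordinates
are exactly those indexed by the bases of `M`. -/
def grThinCell {d n : ℕ} (M : RankMatroid d n) : Set (Gr d n) :=
  {W | ∀ I : Subsets n d, pluckerCoord W I ≠ 0 ↔ M.IsBasis I}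

/-- The thin Schubert cell `𝔽_M = (∏ i, G_{M i}) ∩ 𝔽`, as a subset of the flag variety. -/
def flagThinCell {k n : ℕ} {d : Fin k → ℕ} (M : ∀ i, RankMatroid (d i) n) :
    Set (FlagVariety n d) :=
  FlagVariety.toGr ⁻¹' Set.univ.pi fun i => grThinCell (M i)

end ThinCell

end

/-!
Fix a basis `B i` of each matroid `M i`. On the thin Schubert cell the Plücker coordinate of `W i` at
`B i` is nonzero, so `W i` has a unique basis `a i` whose columns indexed by `B i` form the identity
matrix. Hence the cell is parametrized by `k`-tuples of normalized matrices subject to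
* the vanishing of the maximal minors outside the bases of `M i`,
* the nonvanishing of the minors at the bases, which becomes a polynomial equation after adding one
  coordinate for the inverse of their product,
* the inclusions `W i ≤ W j`: since `a j` is normalized, a vector `w` lies in `W j` exactly if it is
  the combination of the rows of `a j` whose coefficients are the entries of `w` at `B j`
  (`IsNormalized.mem_span_iff`), which is a quadratic condition on the entries of `a i` and `a j`.

So no Plücker relations are needed to see that the coordinates fill a closed algebraic set
(`cellEquiv`). The bijection is regular in both directions. By Cramer's rule each entry of `a i` is,
up to sign, zero or a quotient of a Plücker coordinate by the one at `B i`
(`exists_entry_eq_mul_minors`, `IsNormalized.minors_eq_div`); conversely the homogeneous coordinates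
of the flag are the maximal minors, which are polynomials in the entries.

That a map given by regular coordinates is a morphism rests on the fact that, on all the spaces
considered, regular functions have open nonvanishing loci and regular inverses
(`HasRegularInverses`). The cell is locally closed because it is defined by the vanishing of some and
the nonvanishing of the other Plücker coordinates.
-/

noncomputable section

namespace ThinCell

/-! ### Regular maps -/

section RegularMaps

variable {X Y Z : Type*} [TopologicalSpace X] [TopologicalSpace Y] [TopologicalSpace Z]

/-- A morphism of spaces with regular functions: a continuous map that pulls regular functions on
open sets back to regular functions. -/
structure IsRegularMap [RegularFunctions X] [RegularFunctions Y] (f : X → Y) : Prop where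
  continuous : Continuous f
  comp_isRegularOn : ∀ {V : Set Y} {g : Y → ℂ}, IsOpen V → RegularFunctions.IsRegularOn V g →
    RegularFunctions.IsRegularOn (f ⁻¹' V) (g ∘ f)

theorem IsRegularMap.comp [RegularFunctions X] [RegularFunctions Y] [RegularFunctions Z]
    {g : Y → Z} {f : X → Y} (hg : IsRegularMap g) (hf : IsRegularMap f) : IsRegularMap (g ∘ f) where
  continuous := hg.continuous.comp hf.continuous
  comp_isRegularOn hV hh :=
    hf.comp_isRegularOn (hV.preimage hg.continuous) (hg.comp_isRegularOn hV hh)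

theorem isRegularMap_induced [RegularFunctions Y] {ι : X → Y} (hι : Topology.IsInducing ι) :
    letI := RegularFunctions.induced ι hι
    IsRegularMap ι :=
  let := RegularFunctions.induced ι hι
  { continuous := hι.continuous
    comp_isRegularOn := fun {V g} hV hg _ hx => ⟨V, hV, hx, g, hg, fun _ _ _ => rfl⟩ }

/-- Regularity of a map into a space with the induced structure can be checked after composing
with the inducing map. -/
theorem IsRegularMap.of_comp_induced [RegularFunctions X] [RegularFunctions Z] {ι : Y → Z}
    (hι : Topology.IsInducing ι) {f : X → Y} (hf : IsRegularMap (ι ∘ f)) :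
    letI := RegularFunctions.induced ι hι
    IsRegularMap f := by
  let := RegularFunctions.induced ι hι
  refine ⟨hι.continuous_iff.2 hf.continuous, fun {V g} hV hg => RegularFunctions.locality ?_⟩
  intro x hx
  obtain ⟨V', hV', hxV', h, hh, hgh⟩ := hg (f x) hx
  exact ⟨(ι ∘ f) ⁻¹' V', hV'.preimage hf.continuous, hxV', h ∘ (ι ∘ f),
    RegularFunctions.mono Set.inter_subset_left (hf.comp_isRegularOn hV' hh),
    fun y hy => hgh (f y) hy.2 hy.1⟩

theorem isRegularMap_subtypeVal [RegularFunctions X] (S : Set X) :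
    IsRegularMap (Subtype.val : S → X) :=
  isRegularMap_induced Topology.IsInducing.subtypeVal

theorem IsRegularMap.of_subtypeVal [RegularFunctions X] [RegularFunctions Y] {S : Set Y}
    {f : X → S} (hf : IsRegularMap fun x => (f x : Y)) : IsRegularMap f :=
  IsRegularMap.of_comp_induced Topology.IsInducing.subtypeVal hf

/-- Mutually inverse regular maps form an isomorphism. -/
def RegularIso.ofEquiv [RegularFunctions X] [RegularFunctions Y] (e : X ≃ Y)
    (he : IsRegularMap e) (he' : IsRegularMap e.symm) : RegularIso X Y where
  toEquiv := e
  continuous_toFun := he.continuous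
  continuous_invFun := he'.continuous
  isRegularOn_iff U f hU := by
    refine ⟨fun hf => he.comp_isRegularOn hU hf, fun hf => ?_⟩
    have h := he'.comp_isRegularOn (hU.preimage he.continuous) hf
    have hU' : e.symm ⁻¹' (e ⁻¹' U) = U := by ext; simp
    have hf' : (f ∘ e) ∘ e.symm = f := by ext; simp
    rw [hU'] at h
    exact hf' ▸ h

/-! ### Inverses of regular functions -/

/-- Nonvanishing is an open condition on regular functions, and inverses of regular functions are
regular where they are defined. -/
class HasRegularInverses (X : Type*) [TopologicalSpace X] [RegularFunctions X] : Prop where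
  isOpen_ne_zero : ∀ {U : Set X} {f : X → ℂ}, IsOpen U → RegularFunctions.IsRegularOn U f →
    IsOpen {x ∈ U | f x ≠ 0}
  inv : ∀ {U : Set X} {f : X → ℂ}, IsOpen U → RegularFunctions.IsRegularOn U f →
    RegularFunctions.IsRegularOn {x ∈ U | f x ≠ 0} f⁻¹

theorem HasRegularInverses.of_fractions [RegularFunctions X] (D : (X → ℂ) → (X → ℂ) → Prop)
    (hreg : ∀ (U : Set X) (f : X → ℂ), RegularFunctions.IsRegularOn U f ↔
      ∀ x ∈ U, ∃ V : Set X, IsOpen V ∧ x ∈ V ∧ ∃ p q : X → ℂ, D p q ∧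
        ∀ y ∈ V ∩ U, q y ≠ 0 ∧ f y = p y / q y)
    (hopen : ∀ p q : X → ℂ, D p q → IsOpen {x | p x ≠ 0})
    (hswap : ∀ p q : X → ℂ, D p q → D q p) : HasRegularInverses X := by
  refine ⟨fun {U f} hU hf => isOpen_iff_forall_mem_open.2 ?_, fun {U f} hU hf => ?_⟩
  · rintro x ⟨hx, hfx⟩
    obtain ⟨V, hV, hxV, p, q, hD, h⟩ := (hreg U f).1 hf x hx
    refine ⟨V ∩ U ∩ {y | p y ≠ 0}, ?_, (hV.inter hU).inter (hopen p q hD), ⟨hxV, hx⟩, ?_⟩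
    · rintro y ⟨hy, hpy⟩
      refine ⟨hy.2, ?_⟩
      rw [(h y hy).2]
      exact div_ne_zero hpy (h y hy).1
    · rw [(h x ⟨hxV, hx⟩).2] at hfx
      exact (div_ne_zero_iff.1 hfx).1
  · refine (hreg _ _).2 ?_
    rintro x ⟨hx, hfx⟩
    obtain ⟨V, hV, hxV, p, q, hD, h⟩ := (hreg U f).1 hf x hx
    refine ⟨V, hV, hxV, q, p, hswap p q hD, fun y hy => ?_⟩
    have hy' := h y ⟨hy.1, hy.2.1⟩
    have hfy := hy.2.2
    rw [hy'.2] at hfy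
    exact ⟨(div_ne_zero_iff.1 hfy).1, by rw [Pi.inv_apply, hy'.2, inv_div]⟩

theorem HasRegularInverses.induced [RegularFunctions Y] [HasRegularInverses Y] {ι : X → Y}
    (hι : Topology.IsInducing ι) :
    letI := RegularFunctions.induced ι hι
    HasRegularInverses X := by
  let := RegularFunctions.induced ι hι
  refine ⟨fun {U f} hU hf => isOpen_iff_forall_mem_open.2 ?_, fun {U f} hU hf => ?_⟩
  · rintro x ⟨hx, hfx⟩
    obtain ⟨V, hV, hxV, g, hg, h⟩ := hf x hx
    refine ⟨ι ⁻¹' {y ∈ V | g y ≠ 0} ∩ U, ?_,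
      ((HasRegularInverses.isOpen_ne_zero hV hg).preimage hι.continuous).inter hU,
      ⟨hxV, h x hx hxV ▸ hfx⟩, hx⟩
    rintro y ⟨hy, hyU⟩
    refine ⟨hyU, ?_⟩
    rw [h y hyU hy.1]
    exact hy.2
  · rintro x ⟨hx, hfx⟩
    obtain ⟨V, hV, hxV, g, hg, h⟩ := hf x hx
    refine ⟨{y ∈ V | g y ≠ 0}, HasRegularInverses.isOpen_ne_zero hV hg,
      ⟨hxV, h x hx hxV ▸ hfx⟩, g⁻¹, HasRegularInverses.inv hV hg, fun y hy hyV => ?_⟩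
    simp only [Pi.inv_apply, h y hy.1 hyV.1]

instance [RegularFunctions X] [HasRegularInverses X] (S : Set X) : HasRegularInverses S :=
  HasRegularInverses.induced Topology.IsInducing.subtypeVal

instance (N : ℕ) : HasRegularInverses (AffSpace N) := by
  refine HasRegularInverses.of_fractions _ (fun _ _ => Iff.rfl) ?_ ?_
  · rintro _ _ ⟨P, Q, rfl, rfl⟩
    exact TopologicalSpace.isOpen_generateFrom_of_mem ⟨P, rfl⟩
  · rintro _ _ ⟨P, Q, rfl, rfl⟩
    exact ⟨Q, P, rfl, rfl⟩

instance {k : ℕ} (σ : Fin k → Type) : HasRegularInverses (MultiProj σ) := by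
  refine HasRegularInverses.of_fractions _ (fun _ _ => Iff.rfl) ?_ ?_
  · rintro _ _ ⟨P, Q, e, hP, hQ, rfl, rfl⟩
    exact TopologicalSpace.isOpen_generateFrom_of_mem ⟨P, e, hP, rfl⟩
  · rintro _ _ ⟨P, Q, e, hP, hQ, rfl, rfl⟩
    exact ⟨Q, P, e, hQ, hP, rfl, rfl⟩

theorem FlagVariety.isInducing_plucker {k n : ℕ} (d : Fin k → ℕ) :
    Topology.IsInducing (FlagVariety.plucker (n := n) (d := d)) :=
  ⟨rfl⟩

instance {k n : ℕ} (d : Fin k → ℕ) : HasRegularInverses (FlagVariety n d) :=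
  HasRegularInverses.induced (FlagVariety.isInducing_plucker d)

/-! ### Maps to affine and projective spaces -/

variable [RegularFunctions X]

theorem isRegularOn_eval {ι : Type*} {U : Set X} {g : ι → X → ℂ}
    (hg : ∀ j, RegularFunctions.IsRegularOn U (g j)) (P : MvPolynomial ι ℂ) :
    RegularFunctions.IsRegularOn U fun x => MvPolynomial.eval (fun j => g j x) P := by
  induction P using MvPolynomial.induction_on with
  | C c => simpa using RegularFunctions.const U c
  | add p q hp hq =>
    simp only [map_add]
    exact RegularFunctions.add hp hq
  | mul_X p j hp =>
    simp only [map_mul, MvPolynomial.eval_X]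
    exact RegularFunctions.mul hp (hg j)

variable [HasRegularInverses X]

theorem isRegularOn_div {U : Set X} {f g : X → ℂ} (hU : IsOpen U)
    (hf : RegularFunctions.IsRegularOn U f) (hg : RegularFunctions.IsRegularOn U g)
    (h0 : ∀ x ∈ U, g x ≠ 0) : RegularFunctions.IsRegularOn U fun x => f x / g x := by
  have hsub : U ⊆ {x ∈ U | g x ≠ 0} := fun x hx => ⟨hx, h0 x hx⟩
  have h := RegularFunctions.mono hsub (HasRegularInverses.inv hU hg)
  simp only [div_eq_mul_inv]
  exact RegularFunctions.mul hf h

theorem isOpen_ne_zero_of_isRegularOn_univ {f : X → ℂ}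
    (hf : RegularFunctions.IsRegularOn Set.univ f) : IsOpen {x | f x ≠ 0} := by
  simpa using HasRegularInverses.isOpen_ne_zero isOpen_univ hf

/-- A map to affine space is regular if its coordinates are. -/
theorem isRegularMap_affSpace {N : ℕ} {F : X → AffSpace N}
    (hF : ∀ j, RegularFunctions.IsRegularOn Set.univ fun x => (F x).coord j) :
    IsRegularMap F := by
  have hpoly (P : MvPolynomial (Fin N) ℂ) := isRegularOn_eval hF P
  have hcont : Continuous F := by
    refine continuous_generateFrom_iff.2 ?_
    rintro _ ⟨P, rfl⟩
    exact isOpen_ne_zero_of_isRegularOn_univ (hpoly P)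
  refine ⟨hcont, fun {V g} hV hg => RegularFunctions.locality fun x hx => ?_⟩
  obtain ⟨V', hV', hxV', _, _, ⟨P, Q, rfl, rfl⟩, h⟩ := hg (F x) hx
  refine ⟨F ⁻¹' V', hV'.preimage hcont, hxV', _, isRegularOn_div
    ((hV'.inter hV).preimage hcont) (RegularFunctions.mono (Set.subset_univ _) (hpoly P))
    (RegularFunctions.mono (Set.subset_univ _) (hpoly Q)) fun y hy => (h _ hy).1, fun y hy => ?_⟩
  exact (h _ hy).2

/-- A map to a product of projective spaces is regular if it has regular homogeneous
coordinates. -/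
theorem isRegularMap_multiProj {k : ℕ} {σ : Fin k → Type} {F : X → MultiProj σ}
    {G : ∀ i, σ i → X → ℂ} (hG : ∀ i s, RegularFunctions.IsRegularOn Set.univ (G i s))
    (h0 : ∀ x i, (fun s => G i s x) ≠ 0)
    (hF : ∀ x i, (F x).pt i = Projectivization.mk ℂ (fun s => G i s x) (h0 x i)) :
    IsRegularMap F := by
  have hpoly (P : MvPolynomial (Σ i, σ i) ℂ) :=
    isRegularOn_eval (g := fun s : Σ i, σ i => G s.1 s.2) (fun s => hG s.1 s.2) P
  -- The chosen representative of each factor is a rescaling of the given coordinates, by a factor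
  -- that need not be regular in `x` but cancels in quotients of the same multidegree.
  have hrep (x : X) : ∃ t : Fin k → ℂ, (∀ i, t i ≠ 0) ∧
      ∀ (P : MvPolynomial (Σ i, σ i) ℂ) (e : Fin k → ℕ), IsMultihomogeneous P e →
        (F x).evalRep P =
          (∏ i, t i ^ e i) * MvPolynomial.eval (fun s : Σ i, σ i => G s.1 s.2 x) P := by
    choose t ht using fun i => Projectivization.exists_smul_eq_mk_rep ℂ _ (h0 x i)
    refine ⟨fun i => t i, fun i => (t i).ne_zero, fun P e hP => ?_⟩
    rw [← hP.eval_smul (fun i s => G i s x)]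
    simp only [MultiProj.evalRep, hF, ← ht]
    rfl
  have hcont : Continuous F := by
    refine continuous_generateFrom_iff.2 ?_
    rintro _ ⟨P, e, hP, rfl⟩
    convert isOpen_ne_zero_of_isRegularOn_univ (hpoly P) using 1
    ext x
    obtain ⟨t, ht, h⟩ := hrep x
    simp [h P e hP, Finset.prod_eq_zero_iff, ht]
  refine ⟨hcont, fun {V g} hV hg => RegularFunctions.locality fun x hx => ?_⟩
  obtain ⟨V', hV', hxV', _, _, ⟨P, Q, e, hP, hQ, rfl, rfl⟩, h⟩ := hg (F x) hx
  refine ⟨F ⁻¹' V', hV'.preimage hcont, hxV', _, isRegularOn_div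
    ((hV'.inter hV).preimage hcont) (RegularFunctions.mono (Set.subset_univ _) (hpoly P))
    (RegularFunctions.mono (Set.subset_univ _) (hpoly Q)) fun y hy => ?_, fun y hy => ?_⟩
  · obtain ⟨t, ht, htP⟩ := hrep y
    have := (h _ hy).1
    beta_reduce at this
    rw [htP Q e hQ] at this
    exact right_ne_zero_of_mul this
  · obtain ⟨t, ht, htP⟩ := hrep y
    have hprod : ∏ i, t i ^ e i ≠ 0 := Finset.prod_ne_zero_iff.2 fun i _ => pow_ne_zero _ (ht i)
    rw [Function.comp_apply, (h _ hy).2]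
    beta_reduce
    rw [htP P e hP, htP Q e hQ, mul_div_mul_left _ _ hprod]

/-- A space is affine if its points correspond to the solutions of polynomial equations in finitely
many unknowns, the unknowns are regular functions on it, and every solution in regular functions on
a space defines a regular map from that space. -/
theorem isAffineVariety_of_equiv {ι : Type*} [Fintype ι] {S : Set (MvPolynomial ι ℂ)}
    (e : X ≃ {v : ι → ℂ // ∀ P ∈ S, MvPolynomial.eval v P = 0})
    (he : ∀ j, RegularFunctions.IsRegularOn Set.univ fun x => (e x).1 j)
    (he' : ∀ (T : Type) [TopologicalSpace T] [RegularFunctions T] [HasRegularInverses T]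
      (v : T → {v : ι → ℂ // ∀ P ∈ S, MvPolynomial.eval v P = 0}),
      (∀ j, RegularFunctions.IsRegularOn Set.univ fun t => (v t).1 j) →
        IsRegularMap fun t => e.symm (v t)) : IsAffineVariety X := by
  let σ := Fintype.equivFin ι
  let I := Ideal.span (MvPolynomial.rename σ '' S)
  have hI (x : AffSpace (Fintype.card ι)) : x ∈ affineZeroLocus I ↔
      ∀ P ∈ S, MvPolynomial.eval (x.coord ∘ σ) P = 0 := by
    change x.coord ∈ MvPolynomial.zeroLocus ℂ I ↔ _
    simp [I, MvPolynomial.zeroLocus_span, MvPolynomial.aeval_eq_eval,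
      MvPolynomial.eval_rename]
  let e' : {v : ι → ℂ // ∀ P ∈ S, MvPolynomial.eval v P = 0} ≃ affineZeroLocus I :=
    { toFun := fun v => ⟨⟨v.1 ∘ σ.symm⟩, (hI _).2 (by simpa [Function.comp_assoc] using v.2)⟩
      invFun := fun x => ⟨x.1.coord ∘ σ, (hI _).1 x.2⟩
      left_inv := fun v => by ext; simp
      right_inv := fun x => by
        apply Subtype.ext
        simp [Function.comp_assoc] }
  refine ⟨Fintype.card ι, I, ⟨RegularIso.ofEquiv (e.trans e') (IsRegularMap.of_subtypeVal
    (isRegularMap_affSpace fun j => he (σ.symm j))) (he' _ e'.symm fun j => ?_)⟩⟩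
  have hcoord : RegularFunctions.IsRegularOn Set.univ
      fun x : AffSpace (Fintype.card ι) => x.coord (σ j) := fun x _ =>
    ⟨Set.univ, isOpen_univ, trivial, _, _, ⟨MvPolynomial.X (σ j), 1, rfl, rfl⟩, by simp⟩
  exact (isRegularMap_subtypeVal _).comp_isRegularOn isOpen_univ hcoord

end RegularMaps

/-! ### Normalized bases of a subspace -/

section Normalized

variable {n d : ℕ}

/-- The rows `a 0, …, a (d - 1)` are normalized at `B` if the columns indexed by `B` form the
identity matrix. -/
def IsNormalized (B : Subsets n d) (a : Fin d → Fin n → ℂ) : Prop :=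
  ∀ r c, a r (B.1.orderEmbOfFin B.2 c) = (1 : Matrix (Fin d) (Fin d) ℂ) r c

variable {B : Subsets n d} {a : Fin d → Fin n → ℂ}

theorem IsNormalized.minors_eq_one (ha : IsNormalized B a) : minors a B = 1 := by
  rw [minors, ← Matrix.det_one (n := Fin d)]
  congr 1
  ext r c
  exact ha r c

theorem IsNormalized.linearIndependent (ha : IsNormalized B a) : LinearIndependent ℂ a := by
  refine LinearIndependent.of_comp (LinearMap.funLeft ℂ ℂ (B.1.orderEmbOfFin B.2)) ?_
  have h := Matrix.linearIndependent_rows_of_det_ne_zero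
    (A := (1 : Matrix (Fin d) (Fin d) ℂ)) (by simp)
  rwa [show (fun r => (1 : Matrix (Fin d) (Fin d) ℂ) r) =
    LinearMap.funLeft ℂ ℂ (B.1.orderEmbOfFin B.2) ∘ a from
      funext fun r => funext fun c => (ha r c).symm] at h

theorem IsNormalized.mem_span_iff (ha : IsNormalized B a) (w : Fin n → ℂ) :
    w ∈ Submodule.span ℂ (Set.range a) ↔
      ∀ c, w c = ∑ s, w (B.1.orderEmbOfFin B.2 s) * a s c := by
  constructor
  · rw [Submodule.mem_span_range_iff_exists_fun]
    rintro ⟨x, rfl⟩ c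
    have hx (s : Fin d) : (∑ t, x t • a t) (B.1.orderEmbOfFin B.2 s) = x s := by
      simp [Finset.sum_apply, ha _ s, Matrix.one_apply]
    simp only [hx]
    simp [Finset.sum_apply]
  · intro h
    have hw : w = ∑ s, w (B.1.orderEmbOfFin B.2 s) • a s := by
      ext c
      simpa [Finset.sum_apply] using h c
    rw [hw]
    exact Submodule.sum_mem _ fun s _ =>
      Submodule.smul_mem _ _ (Submodule.subset_span (Set.mem_range_self s))

/-- By Cramer's rule for the identity matrix. -/
theorem IsNormalized.det_update_eq (ha : IsNormalized B a) (r : Fin d) (c : Fin n) :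
    (Matrix.of fun s t => a s (Function.update (B.1.orderEmbOfFin B.2) r c t)).det = a r c := by
  have h := Matrix.cramer_apply (1 : Matrix (Fin d) (Fin d) ℂ) (fun s => a s c) r
  rw [Matrix.cramer_one] at h
  rw [show a r c = (1 : Module.End ℂ (Fin d → ℂ)) (fun s => a s c) r from rfl]
  refine Eq.trans ?_ h.symm
  congr 1
  ext s t
  rcases eq_or_ne t r with rfl | ht
  · simp
  · simp [ht, ha s t]

/-- A determinant of any `d` columns is, up to sign, either zero or a maximal minor. -/
theorem exists_det_eq_mul_minors [Nonempty (Subsets n d)] (J : Fin d → Fin n) :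
    ∃ (c : ℂ) (I : Subsets n d), ∀ b : Fin d → Fin n → ℂ,
      (Matrix.of fun r t => b r (J t)).det = c * minors b I := by
  by_cases hJ : Function.Injective J
  · let I : Subsets n d := ⟨Finset.univ.image J, by simp [Finset.card_image_of_injective _ hJ]⟩
    let e : Fin d → I.1 := fun t => ⟨J t, by simp [I]⟩
    have he : Function.Injective e := fun s t h => hJ (congrArg Subtype.val h)
    let f : Fin d → Fin d := fun t => (I.1.orderIsoOfFin I.2).symm (e t)
    have hf : Function.Bijective f :=
      Finite.injective_iff_bijective.1 ((I.1.orderIsoOfFin I.2).symm.injective.comp he)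
    let σ : Equiv.Perm (Fin d) := Equiv.ofBijective f hf
    refine ⟨Equiv.Perm.sign σ, I, fun b => ?_⟩
    rw [minors, ← Matrix.det_permute']
    congr 1
    ext r t
    have hσ : I.1.orderEmbOfFin I.2 (σ t) = J t := by
      change ((I.1.orderIsoOfFin I.2 ((I.1.orderIsoOfFin I.2).symm (e t)) : I.1) : Fin n) = J t
      rw [OrderIso.apply_symm_apply]
    simp [hσ]
  · obtain ⟨s, t, hst, hne⟩ : ∃ s t, J s = J t ∧ s ≠ t := by
      simpa [Function.Injective] using hJ
    refine ⟨0, Classical.arbitrary _, fun b => ?_⟩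
    rw [zero_mul]
    exact Matrix.det_zero_of_column_eq hne fun r => by simp [hst]

/-- The entries of a normalized matrix are linear in its maximal minors. -/
theorem exists_entry_eq_mul_minors (B : Subsets n d) (r : Fin d) (c : Fin n) :
    ∃ (s : ℂ) (I : Subsets n d), ∀ a, IsNormalized B a → a r c = s * minors a I := by
  have : Nonempty (Subsets n d) := ⟨B⟩
  obtain ⟨s, I, h⟩ := exists_det_eq_mul_minors (Function.update (B.1.orderEmbOfFin B.2) r c)
  exact ⟨s, I, fun a ha => by rw [← ha.det_update_eq r c, h]⟩

/-- The row space of a matrix with independent rows. -/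
def rowSpace (a : Fin d → Fin n → ℂ) (ha : LinearIndependent ℂ a) : Gr d n where
  space := Submodule.span ℂ (Set.range a)
  finrank_eq := by rw [finrank_span_eq_card ha, Fintype.card_fin]

theorem plucker_rowSpace (ha : LinearIndependent ℂ a) :
    plucker (rowSpace a ha) = Projectivization.mk ℂ (minors a) (minors_ne_zero ha) := by
  rw [plucker_eq _ (Module.Basis.span ha)]
  congr 1
  exact congrArg minors (funext fun r => congrArg Subtype.val (Module.Basis.span_apply ha r))

theorem exists_pluckerCoord_rowSpace (ha : LinearIndependent ℂ a) :
    ∃ t : ℂ, t ≠ 0 ∧ ∀ I, pluckerCoord (rowSpace a ha) I = t * minors a I := by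
  obtain ⟨t, ht⟩ := Projectivization.exists_smul_eq_mk_rep ℂ _ (minors_ne_zero ha)
  exact ⟨t, t.ne_zero, fun I => by rw [pluckerCoord, plucker_rowSpace, ← ht]; rfl⟩

theorem pluckerCoord_rowSpace_ne_zero_iff (ha : LinearIndependent ℂ a) (I : Subsets n d) :
    pluckerCoord (rowSpace a ha) I ≠ 0 ↔ minors a I ≠ 0 := by
  obtain ⟨t, ht, h⟩ := exists_pluckerCoord_rowSpace ha
  simp [h, ht]

theorem IsNormalized.minors_eq_div (ha : IsNormalized B a) (I : Subsets n d) :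
    minors a I = pluckerCoord (rowSpace a ha.linearIndependent) I /
      pluckerCoord (rowSpace a ha.linearIndependent) B := by
  obtain ⟨t, ht, h⟩ := exists_pluckerCoord_rowSpace ha.linearIndependent
  rw [h, h, ha.minors_eq_one, mul_one, mul_div_cancel_left₀ _ ht]

theorem exists_isNormalized {W : Gr d n} (hW : pluckerCoord W B ≠ 0) :
    ∃ (a : Fin d → Fin n → ℂ) (ha : IsNormalized B a), rowSpace a ha.linearIndependent = W := by
  let b := Module.finBasisOfFinrankEq ℂ W.space W.finrank_eq
  have hb := (pluckerCoord_ne_zero_iff W b B).1 hW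
  let f : W.space →ₗ[ℂ] (Fin d → ℂ) :=
    LinearMap.funLeft ℂ ℂ (B.1.orderEmbOfFin B.2) ∘ₗ W.space.subtype
  have hf : Function.Injective f := by
    rw [← LinearMap.ker_eq_bot, LinearMap.ker_eq_bot']
    intro w hw
    have hsum : ∑ r, b.repr w r • f (b r) = 0 := by
      simp only [← map_smul, ← map_sum, b.sum_repr, hw]
    have h0 : (b.repr w : Fin d → ℂ) = 0 := by
      refine Matrix.eq_zero_of_vecMul_eq_zero hb ?_
      ext c
      simpa [f, Matrix.vecMul, dotProduct] using congrFun hsum c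
    rw [← b.sum_repr w]
    exact Finset.sum_eq_zero fun r _ => by rw [congrFun h0 r]; simp
  let g : W.space ≃ₗ[ℂ] (Fin d → ℂ) :=
    LinearEquiv.ofInjectiveOfFinrankEq f hf (by simp [W.finrank_eq])
  let a : Module.Basis (Fin d) ℂ W.space := Module.Basis.ofEquivFun g
  have ha : IsNormalized B fun r => (a r : Fin n → ℂ) := by
    intro r c
    have h : f (a r) = Pi.single r 1 := by
      change g (a r) = _
      simp [a]
    simpa [f, Matrix.one_apply, Pi.single_apply, eq_comm] using congrFun h c
  refine ⟨_, ha, ?_⟩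
  have hspan : Submodule.span ℂ (Set.range fun r => (a r : Fin n → ℂ)) = W.space := by
    have h := congrArg (Submodule.map W.space.subtype) a.span_eq
    rw [Submodule.map_span, ← Set.range_comp, Submodule.map_subtype_top] at h
    exact h
  cases W
  simpa [rowSpace] using hspan

/-- A subspace has at most one normalized basis. -/
theorem IsNormalized.eq_of_rowSpace_eq {a' : Fin d → Fin n → ℂ} (ha : IsNormalized B a)
    (ha' : IsNormalized B a')
    (h : rowSpace a ha.linearIndependent = rowSpace a' ha'.linearIndependent) : a = a' := by
  ext r c
  obtain ⟨s, I, hs⟩ := exists_entry_eq_mul_minors B r c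
  rw [hs a ha, hs a' ha', ha.minors_eq_div, ha'.minors_eq_div, h]

end Normalized

/-! ### Local closedness -/

section Cell

variable {k n : ℕ} {d : Fin k → ℕ}

theorem isMultihomogeneous_X {σ : Fin k → Type} (i : Fin k) (s : σ i) :
    IsMultihomogeneous (MvPolynomial.X ⟨i, s⟩ : MvPolynomial (Σ i, σ i) ℂ) (Pi.single i 1) :=
  MvPolynomial.isWeightedHomogeneous_X _ _ _

theorem isOpen_setOf_rep_ne_zero {σ : Fin k → Type} (i : Fin k) (s : σ i) :
    IsOpen {x : MultiProj σ | (x.pt i).rep s ≠ 0} :=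
  TopologicalSpace.isOpen_generateFrom_of_mem
    ⟨MvPolynomial.X ⟨i, s⟩, _, isMultihomogeneous_X i s, by simp [MultiProj.evalRep]⟩

/-- Ratios of homogeneous coordinates are regular. -/
theorem isRegularOn_rep_div_rep {σ : Fin k → Type} (i : Fin k) (s t : σ i) :
    RegularFunctions.IsRegularOn {x : MultiProj σ | (x.pt i).rep t ≠ 0}
      fun x => (x.pt i).rep s / (x.pt i).rep t := fun x hx =>
  ⟨_, isOpen_setOf_rep_ne_zero i t, hx, _, _, ⟨MvPolynomial.X ⟨i, s⟩, MvPolynomial.X ⟨i, t⟩, _,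
    isMultihomogeneous_X i s, isMultihomogeneous_X i t, rfl, rfl⟩, fun y hy => by
      simpa [MultiProj.evalRep] using hy.1⟩

theorem isOpen_setOf_pluckerCoord_ne_zero (i : Fin k) (I : Subsets n (d i)) :
    IsOpen {W : FlagVariety n d | pluckerCoord (W.toGr i) I ≠ 0} :=
  (isOpen_setOf_rep_ne_zero (σ := fun i => Subsets n (d i)) i I).preimage (FlagVariety.isInducing_plucker d).continuous

theorem mem_flagThinCell_iff {M : ∀ i, RankMatroid (d i) n} {W : FlagVariety n d} :
    W ∈ flagThinCell M ↔ ∀ i I, pluckerCoord (W.toGr i) I ≠ 0 ↔ (M i).IsBasis I := by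
  simp [flagThinCell, grThinCell]

theorem isLocallyClosed_flagThinCell (M : ∀ i, RankMatroid (d i) n) :
    IsLocallyClosed (flagThinCell M) := by
  have h : flagThinCell M =
      (⋂ i, ⋂ I : {I // (M i).IsBasis I}, {W | pluckerCoord (W.toGr i) I.1 ≠ 0}) ∩
      ⋂ i, ⋂ I : {I // ¬ (M i).IsBasis I}, {W | pluckerCoord (W.toGr i) I.1 ≠ 0}ᶜ := by
    ext W
    simp only [mem_flagThinCell_iff, Set.mem_inter_iff, Set.mem_iInter, Set.mem_ofPred_eq,
      Set.mem_compl_iff, Subtype.forall, ← forall_and]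
    exact forall_congr' fun i => forall₂_congr fun I hI => by tauto
  rw [h]
  refine IsLocallyClosed.inter (IsOpen.isLocallyClosed ?_) (IsClosed.isLocallyClosed ?_)
  · exact isOpen_iInter_of_finite fun i => isOpen_iInter_of_finite fun I =>
      isOpen_setOf_pluckerCoord_ne_zero i I.1
  · exact isClosed_iInter fun i => isClosed_iInter fun I =>
      (isOpen_setOf_pluckerCoord_ne_zero i I.1).isClosed_compl

theorem RankMatroid.exists_isBasis {d n : ℕ} (M : RankMatroid d n) : ∃ B, M.IsBasis B := by
  classical
  obtain ⟨B, hB⟩ := M.matroid.exists_isBase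
  refine ⟨⟨B.toFinset, ?_⟩, by simpa [RankMatroid.IsBasis] using hB⟩
  have h := hB.encard_eq_eRank
  rw [M.eRank_eq, Set.encard_eq_coe_toFinset_card] at h
  exact_mod_cast h

/-! ### Affine coordinates on the cell -/

/-- The affine coordinates on the cell: the entries of `k` matrices of sizes `d i × n`, and, at
`none`, the inverse of the product of all minors indexed by bases. -/
abbrev CellIndex (n : ℕ) (d : Fin k → ℕ) : Type := Option (Σ i, Fin (d i) × Fin n)

/-- The `i`-th matrix encoded by the coordinates `v`. -/
def cellRows {R : Type*} (v : CellIndex n d → R) (i : Fin k) : Fin (d i) → Fin n → R :=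
  fun r c => v (some ⟨i, r, c⟩)

open Classical in
/-- The bases of `M`, as a finite set. -/
def RankMatroid.bases {d n : ℕ} (M : RankMatroid d n) : Finset (Subsets n d) :=
  Finset.univ.filter M.IsBasis

theorem RankMatroid.mem_bases {d n : ℕ} {M : RankMatroid d n} {I : Subsets n d} :
    I ∈ M.bases ↔ M.IsBasis I := by
  simp [RankMatroid.bases]

/-- The conditions that cut out the cell in the coordinates `v`: each matrix is normalized at
`B i`, its minors vanish outside the bases of `M i`, the minors at the bases are invertible with the
inverse of their product given by the last coordinate, and the row spaces form a flag. -/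
structure IsCellPoint (M : ∀ i, RankMatroid (d i) n) (B : ∀ i, Subsets n (d i))
    (v : CellIndex n d → ℂ) : Prop where
  isNormalized : ∀ i, IsNormalized (B i) (cellRows v i)
  minors_eq_zero : ∀ i I, ¬ (M i).IsBasis I → minors (cellRows v i) I = 0
  mul_prod_eq_one : v none * ∏ i, ∏ I ∈ (M i).bases, minors (cellRows v i) I = 1
  flag : ∀ i j, i ≤ j → ∀ r c, cellRows v i r c =
    ∑ s, cellRows v i r ((B j).1.orderEmbOfFin (B j).2 s) * cellRows v j s c

/-- The maximal minors of the matrices of unknowns. -/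
def minorPoly (i : Fin k) (I : Subsets n (d i)) : MvPolynomial (CellIndex n d) ℂ :=
  (Matrix.of fun r c : Fin (d i) =>
    cellRows MvPolynomial.X i r (I.1.orderEmbOfFin I.2 c)).det

@[simp]
theorem eval_cellRows_X (v : CellIndex n d → ℂ) (i : Fin k) (r : Fin (d i)) (c : Fin n) :
    MvPolynomial.eval v (cellRows MvPolynomial.X i r c) = cellRows v i r c :=
  MvPolynomial.eval_X _

@[simp]
theorem eval_minorPoly (v : CellIndex n d → ℂ) (i : Fin k) (I : Subsets n (d i)) :
    MvPolynomial.eval v (minorPoly i I) = minors (cellRows v i) I := by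
  rw [minorPoly, RingHom.map_det, minors]
  congr 1
  ext r c
  simp

/-- The polynomial form of the conditions in `IsCellPoint`. -/
inductive IsCellEquation (M : ∀ i, RankMatroid (d i) n) (B : ∀ i, Subsets n (d i)) :
    MvPolynomial (CellIndex n d) ℂ → Prop
  | normalized (i : Fin k) (r c : Fin (d i)) : IsCellEquation M B
      (cellRows MvPolynomial.X i r ((B i).1.orderEmbOfFin (B i).2 c) -
        MvPolynomial.C ((1 : Matrix (Fin (d i)) (Fin (d i)) ℂ) r c))
  | nonbasis (i : Fin k) (I : Subsets n (d i)) : ¬ (M i).IsBasis I →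
      IsCellEquation M B (minorPoly i I)
  | inverse : IsCellEquation M B
      (MvPolynomial.X none * (∏ i, ∏ I ∈ (M i).bases, minorPoly i I) - 1)
  | flag (i j : Fin k) (r : Fin (d i)) (c : Fin n) : i ≤ j → IsCellEquation M B
      (cellRows MvPolynomial.X i r c -
        ∑ s, cellRows MvPolynomial.X i r ((B j).1.orderEmbOfFin (B j).2 s) *
          cellRows MvPolynomial.X j s c)

theorem isCellPoint_iff {M : ∀ i, RankMatroid (d i) n} {B : ∀ i, Subsets n (d i)}
    {v : CellIndex n d → ℂ} :
    IsCellPoint M B v ↔ ∀ P ∈ {P | IsCellEquation M B P}, MvPolynomial.eval v P = 0 := by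
  constructor
  · rintro h _ (⟨i, r, c⟩ | ⟨i, I, hI⟩ | _ | ⟨i, j, r, c, hij⟩)
    · simpa [sub_eq_zero] using h.isNormalized i r c
    · simpa using h.minors_eq_zero i I hI
    · simpa [sub_eq_zero] using h.mul_prod_eq_one
    · simpa [sub_eq_zero] using h.flag i j hij r c
  · intro h
    refine ⟨fun i r c => ?_, fun i I hI => ?_, ?_, fun i j hij r c => ?_⟩
    · simpa [sub_eq_zero] using h _ (.normalized i r c)
    · simpa using h _ (.nonbasis i I hI)
    · simpa [sub_eq_zero] using h _ .inverse
    · simpa [sub_eq_zero] using h _ (.flag i j r c hij)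

variable {M : ∀ i, RankMatroid (d i) n} {B : ∀ i, Subsets n (d i)}

theorem IsCellPoint.minors_ne_zero {v : CellIndex n d → ℂ} (h : IsCellPoint M B v) (i : Fin k)
    (I : Subsets n (d i)) : minors (cellRows v i) I ≠ 0 ↔ (M i).IsBasis I := by
  refine ⟨fun h0 => by_contra fun hI => h0 (h.minors_eq_zero i I hI), fun hI => ?_⟩
  have h1 := right_ne_zero_of_mul (h.mul_prod_eq_one.symm ▸ one_ne_zero)
  exact Finset.prod_ne_zero_iff.1 (Finset.prod_ne_zero_iff.1 h1 i (Finset.mem_univ i)) I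
    (RankMatroid.mem_bases.2 hI)

/-- The flag of row spaces. -/
def IsCellPoint.toFlag {v : CellIndex n d → ℂ} (h : IsCellPoint M B v) : FlagVariety n d where
  toGr i := rowSpace (cellRows v i) (h.isNormalized i).linearIndependent
  mono i j hij := by
    refine Submodule.span_le.2 ?_
    rintro _ ⟨r, rfl⟩
    exact ((h.isNormalized j).mem_span_iff _).2 (h.flag i j hij r)

theorem IsCellPoint.toFlag_mem {v : CellIndex n d → ℂ} (h : IsCellPoint M B v) :
    h.toFlag ∈ flagThinCell M :=
  mem_flagThinCell_iff.2 fun i I =>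
    (pluckerCoord_rowSpace_ne_zero_iff (h.isNormalized i).linearIndependent I).trans (h.minors_ne_zero i I)

theorem IsCellPoint.toFlag_injective {v w : CellIndex n d → ℂ} (hv : IsCellPoint M B v)
    (hw : IsCellPoint M B w) (h : hv.toFlag = hw.toFlag) : v = w := by
  have hrows (i : Fin k) : cellRows v i = cellRows w i :=
    (hv.isNormalized i).eq_of_rowSpace_eq (hw.isNormalized i)
      (congrFun (congrArg FlagVariety.toGr h) i)
  funext j
  rcases j with _ | ⟨i, r, c⟩
  · have h1 := hv.mul_prod_eq_one
    have h2 := hw.mul_prod_eq_one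
    simp only [hrows] at h1
    exact mul_right_cancel₀ (right_ne_zero_of_mul (h1.symm ▸ one_ne_zero)) (h1.trans h2.symm)
  · exact congrFun (congrFun (hrows i) r) c

theorem exists_isCellPoint (hB : ∀ i, (M i).IsBasis (B i)) {W : FlagVariety n d}
    (hW : W ∈ flagThinCell M) :
    ∃ (v : CellIndex n d → ℂ) (h : IsCellPoint M B v), h.toFlag = W := by
  rw [mem_flagThinCell_iff] at hW
  choose a ha haW using fun i => exists_isNormalized ((hW i (B i)).2 (hB i))
  have hmin (i : Fin k) (I : Subsets n (d i)) : minors (a i) I ≠ 0 ↔ (M i).IsBasis I := by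
    rw [← hW i I, ← haW i, pluckerCoord_rowSpace_ne_zero_iff]
  have hprod : ∏ i, ∏ I ∈ (M i).bases, minors (a i) I ≠ 0 :=
    Finset.prod_ne_zero_iff.2 fun i _ => Finset.prod_ne_zero_iff.2 fun I hI =>
      (hmin i I).2 (RankMatroid.mem_bases.1 hI)
  let v : CellIndex n d → ℂ := fun j =>
    j.elim (∏ i, ∏ I ∈ (M i).bases, minors (a i) I)⁻¹ fun s => a s.1 s.2.1 s.2.2
  have hv : IsCellPoint M B v := by
    refine ⟨ha, fun i I hI => not_not.1 (mt (hmin i I).1 hI), inv_mul_cancel₀ hprod,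
      fun i j hij r c => ?_⟩
    have hmem : a i r ∈ (rowSpace (a j) (ha j).linearIndependent).space := by
      rw [haW j]
      refine W.mono i j hij ?_
      rw [← haW i]
      exact Submodule.subset_span (Set.mem_range_self r)
    exact ((ha j).mem_span_iff _).1 hmem c
  refine ⟨v, hv, ?_⟩
  cases W
  exact (FlagVariety.mk.injEq ..).mpr (funext haW)

/-- The points of the cell correspond to the solutions of its equations. -/
def cellEquiv (hB : ∀ i, (M i).IsBasis (B i)) :
    flagThinCell M ≃ {v : CellIndex n d → ℂ //
      ∀ P ∈ {P | IsCellEquation M B P}, MvPolynomial.eval v P = 0} :=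
  (Equiv.ofBijective (fun v => ⟨(isCellPoint_iff.2 v.2).toFlag, IsCellPoint.toFlag_mem _⟩)
    ⟨fun v w h => Subtype.ext (IsCellPoint.toFlag_injective (isCellPoint_iff.2 v.2)
        (isCellPoint_iff.2 w.2) (congrArg Subtype.val h)),
      fun W => by
        obtain ⟨v, hv, h⟩ := exists_isCellPoint hB W.2
        exact ⟨⟨v, isCellPoint_iff.1 hv⟩, Subtype.ext h⟩⟩).symm

theorem isRegularOn_pluckerCoord_div (hB : ∀ i, (M i).IsBasis (B i)) (i : Fin k)
    (I : Subsets n (d i)) : RegularFunctions.IsRegularOn Set.univ fun W : flagThinCell M =>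
      pluckerCoord (W.1.toGr i) I / pluckerCoord (W.1.toGr i) (B i) := by
  have h := ((isRegularMap_induced (FlagVariety.isInducing_plucker (n := n) d)).comp
    (isRegularMap_subtypeVal (flagThinCell M))).comp_isRegularOn
      (isOpen_setOf_rep_ne_zero (σ := fun i => Subsets n (d i)) i (B i))
      (isRegularOn_rep_div_rep (σ := fun i => Subsets n (d i)) i I (B i))
  exact RegularFunctions.mono (fun W _ => (mem_flagThinCell_iff.1 W.2 i (B i)).2 (hB i)) h

theorem isAffineVariety_flagThinCell (M : ∀ i, RankMatroid (d i) n) :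
    IsAffineVariety (flagThinCell M) := by
  choose B hB using fun i => (M i).exists_isBasis
  have hpoint (W : flagThinCell M) : IsCellPoint M B (cellEquiv hB W).1 :=
    isCellPoint_iff.2 (cellEquiv hB W).2
  have hminors (W : flagThinCell M) (i : Fin k) (I : Subsets n (d i)) :
      minors (cellRows (cellEquiv hB W).1 i) I =
        pluckerCoord (W.1.toGr i) I / pluckerCoord (W.1.toGr i) (B i) := by
    have hW : (hpoint W).toFlag = W.1 := congrArg Subtype.val ((cellEquiv hB).symm_apply_apply W)
    rw [((hpoint W).isNormalized i).minors_eq_div, ← hW]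
    rfl
  have hreg (i : Fin k) (I : Subsets n (d i)) : RegularFunctions.IsRegularOn Set.univ
      fun W : flagThinCell M => minors (cellRows (cellEquiv hB W).1 i) I := by
    simp only [hminors]
    exact isRegularOn_pluckerCoord_div hB i I
  refine isAffineVariety_of_equiv (cellEquiv hB) (fun j => ?_) fun T _ _ _ v hv => ?_
  · rcases j with _ | ⟨i, r, c⟩
    · have hprod := isRegularOn_eval (g := fun (s : Σ i, Subsets n (d i)) (W : flagThinCell M) =>
        minors (cellRows (cellEquiv hB W).1 s.1) s.2) (fun s => hreg s.1 s.2)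
        (∏ i, ∏ I ∈ (M i).bases, MvPolynomial.X ⟨i, I⟩)
      simp only [map_prod, MvPolynomial.eval_X] at hprod
      have h1 (W : flagThinCell M) := (hpoint W).mul_prod_eq_one
      have h0 (W : flagThinCell M) := right_ne_zero_of_mul ((h1 W).symm ▸ one_ne_zero)
      simp only [fun W => eq_div_of_mul_eq (h0 W) (h1 W)]
      exact isRegularOn_div isOpen_univ (RegularFunctions.const _ 1) hprod fun W _ => h0 W
    · obtain ⟨s, I, h⟩ := exists_entry_eq_mul_minors (B i) r c
      have hentry (W : flagThinCell M) := h _ ((hpoint W).isNormalized i)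
      simp only [cellRows] at hentry
      simp only [hentry]
      exact RegularFunctions.mul (RegularFunctions.const _ s) (hreg i I)
  · have hpt (t : T) : IsCellPoint M B (v t).1 := isCellPoint_iff.2 (v t).2
    refine IsRegularMap.of_subtypeVal (IsRegularMap.of_comp_induced
      (FlagVariety.isInducing_plucker d) (isRegularMap_multiProj
        (G := fun i I t => minors (cellRows (v t).1 i) I) (fun i I => ?_)
        (fun t i => ThinCell.minors_ne_zero ((hpt t).isNormalized i).linearIndependent)
        fun t i => plucker_rowSpace ((hpt t).isNormalized i).linearIndependent))
    simpa only [eval_minorPoly] using isRegularOn_eval hv (minorPoly i I)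

end Cell

end ThinCell

end

theorem mainTheorem7 {k n : ℕ} (d : Fin k → ℕ) (hd : StrictMono d)
    (hpos : ∀ i, 0 < d i) (hlt : ∀ i, d i < n)
    (M : ∀ i, ThinCell.RankMatroid (d i) n) :
    ThinCell.flagThinCell M = {W : ThinCell.FlagVariety n d |
      ∀ (i : Fin k) (I : ThinCell.Subsets n (d i)),
        ThinCell.pluckerCoord (W.toGr i) I ≠ 0 ↔ (M i).IsBasis I} ∧
    IsLocallyClosed (ThinCell.flagThinCell M) ∧
    ThinCell.IsAffineVariety (ThinCell.flagThinCell M) :=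
  ⟨Set.ext fun _ => ThinCell.mem_flagThinCell_iff, ThinCell.isLocallyClosed_flagThinCell M,
    ThinCell.isAffineVariety_flagThinCell M⟩
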